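/- A \emph{quasi-Borel space} is a set $X$ with a set $M_X$ of functions $\mathbb R\to X$ (the random elements) that contains all constant functions, is closed under precomposition with Borel measurable functions $\mathbb R\to\mathbb R$, and is closed under countable case splitting: if $\mathbb R=\bigcup_{n\in\mathbb N}U_n$ with the $U_n$ Borel and pairwise disjoint and $\alpha_n\in M_X$ for all $n$, then the function equal to $\alpha_n$ on $U_n$ for each $n$ is in $M_X$. An \emph{$\omega$-cpo} is a partially ordered set in which every increasing sequence $a_0\le a_1\le\cdots$ has a least upper bound; a map between $\omega$-cpos is \emph{Scott-continuous} if it is monotone and preserves these least upper bounds. An \emph{$\omega$-quasi-Borel space} is a set $P$ with a quasi-Borel structure $M_P$ and an $\omega$-cpo structure $\le_P$ such that, for all $\alpha_0\le\alpha_1\le\cdots$ in $M_P$ (pointwise order), the pointwise supremum $r\mapsto\sup_n\alpha_n(r)$ is in $M_P$. Let $\omega\mathbf{Qbs}$ be the category whose objects are the (small) $\omega$-quasi-Borel spaces and whose morphisms $f:P\to Q$ are the Scott-continuous functions with $f\circ\alpha\in M_Q$ for all $\alpha\in M_P$. \textbf{Corollary.} Let $\kappa=\beth_1^+=(2^{\aleph_0})^+$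 be the successor cardinal of the continuum. The category $\omega\mathbf{Qbs}$ is locally $\kappa$-presentable, that is, it is locally small and cocomplete and has a set of $\kappa$-presentable objects such that every object is a $\kappa$-filtered colimit of objects in this set. In particular, $\omega\mathbf{Qbs}$ has all small limits and all small colimits. -/

import Mathlib

open CategoryTheory CategoryTheory.Limits OmegaCompletePartialOrder

universe u

/-- A quasi-Borel space structure on `X`: a set of functions `ℝ → X`, the random elements. -/
class QuasiBorelSpace (X : Type u) where
  /-- The set of random elements. -/
  randomElements : Set (ℝ → X)
  /-- Constant functions are random elements. -/
  const_mem : ∀ x : X, (fun _ : ℝ => x) ∈ randomElements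
  /-- Random elements are closed under precomposition with Borel measurable functions. -/
  comp_mem : ∀ α ∈ randomElements, ∀ φ : ℝ → ℝ, Measurable φ → α ∘ φ ∈ randomElements
  /-- Random elements are closed under countable measurable case splitting: if `U` is a
  measurable partition of `ℝ` and `β` agrees on each `U n` with the random element `α n`,
  then `β` is a random element. -/
  cases_mem : ∀ U : ℕ → Set ℝ, (∀ n, MeasurableSet (U n)) → Pairwise (Function.onFun Disjoint U) →
    (⋃ n, U n) = Set.univ → ∀ α : ℕ → ℝ → X, (∀ n, α n ∈ randomElements) →
    ∀ β : ℝ → X, (∀ n, ∀ r ∈ U n, β r = α n r) → β ∈ randomElements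

/-- A quasi-Borel pre-domain structure: an ω-cpo and a quasi-Borel space on the same carrier,
such that the random elements are closed under pointwise suprema of ω-chains with respect to
the pointwise order. -/
class OmegaQuasiBorelSpace (X : Type u) extends OmegaCompletePartialOrder X,
    QuasiBorelSpace X where
  /-- Closure of the random elements under pointwise suprema of pointwise ω-chains. -/
  sup_mem : ∀ α : Chain (ℝ → X), (∀ n, α n ∈ randomElements) →
    (fun r => ωSup (α.map (Pi.evalOrderHom r))) ∈ randomElements

/-- Bundled quasi-Borel pre-domains (ω-quasi-Borel spaces). -/
structure ωQbs : Type (u + 1) where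
  /-- The carrier. -/
  carrier : Type u
  [str : OmegaQuasiBorelSpace carrier]

namespace ωQbs

attribute [instance] ωQbs.str

instance : CoeSort ωQbs.{u} (Type u) := ⟨carrier⟩

/-- Morphisms: Scott-continuous functions that preserve random elements. -/
@[ext]
structure Hom (P Q : ωQbs.{u}) where
  /-- The underlying Scott-continuous function. -/
  toContinuousHom : P.carrier →𝒄 Q.carrier
  /-- Postcomposition preserves random elements. -/
  comp_mem : ∀ α ∈ QuasiBorelSpace.randomElements (X := P.carrier),
    (fun r => toContinuousHom (α r)) ∈ QuasiBorelSpace.randomElements (X := Q.carrier)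

instance : Category.{u} ωQbs.{u} where
  Hom P Q := Hom P Q
  id _ := ⟨ContinuousHom.id, fun _ h => h⟩
  comp f g := ⟨g.toContinuousHom.comp f.toContinuousHom,
    fun α h => g.comp_mem _ (f.comp_mem α h)⟩

end ωQbs

/-- The successor of the continuum is a regular cardinal. -/
instance fact_isRegular_succ_continuum :
    Fact (Order.succ Cardinal.continuum.{u}).IsRegular :=
  ⟨Cardinal.isRegular_succ Cardinal.aleph0_le_continuum⟩

namespace ωQbs

open QuasiBorelSpace Function

/-! A cocomplete category with a strong generator made of `κ`-presentable objects is locally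
`κ`-presentable. Here the generator consists of the discretely ordered real line, whose maps into
`P` are the random elements of `P`, and the two-element chain, whose maps into `P` are the
inequalities in `P`. Points, order and random elements make up the whole structure, so a
monomorphism along which both kinds of map lift is an isomorphism (`isIso_of_lifts`).

Both generators are `κ`-presentable because `κ`-filtered colimits are computed on underlying sets
when `κ` exceeds the continuum: a chain, a countable family of random elements, or a family of
inequalities indexed by `ℕ × ℝ` already lives at a single stage.

Limits are compatible families in products. Colimits come from the adjoint functor theorem applied
to the diagonal functor: any cocone factors through the closure of its image under iterated
ω-suprema, and the points of that closure are named by countably branching trees, which form a set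
independent of the target. -/

instance (P Q : ωQbs.{u}) : FunLike (Hom P Q) P Q where
  coe f := f.toContinuousHom
  coe_injective _ _ h := Hom.ext (DFunLike.coe_injective h)

instance : ConcreteCategory ωQbs.{u} Hom where
  hom f := f
  ofHom f := f

section Morphisms

variable {P Q : ωQbs.{u}}

theorem hom_ext {f g : P ⟶ Q} (h : ∀ x, f x = g x) : f = g :=
  Hom.ext (DFunLike.ext _ _ h)

theorem hom_monotone (f : P ⟶ Q) : Monotone f := f.toContinuousHom.monotone

theorem hom_map_ωSup (f : P ⟶ Q) (c : Chain P) :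
    f (ωSup c) = ωSup (c.map ⟨f, hom_monotone f⟩) :=
  f.toContinuousHom.map_ωSup' c

theorem hom_comp_mem (f : P ⟶ Q) {α : ℝ → P} (h : α ∈ randomElements) :
    (fun r => f (α r)) ∈ randomElements (X := Q) :=
  f.comp_mem α h

/-- Build a morphism from its underlying function. -/
def mkHom (f : P → Q) (hf : Monotone f)
    (hsup : ∀ c : Chain P, f (ωSup c) = ωSup (c.map ⟨f, hf⟩))
    (hmem : ∀ α ∈ randomElements (X := P), (fun r => f (α r)) ∈ randomElements (X := Q)) :
    P ⟶ Q :=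
  Hom.mk ⟨⟨f, hf⟩, hsup⟩ hmem

/-- The constant morphism. -/
def constHom (P : ωQbs.{u}) (y : Q) : P ⟶ Q :=
  mkHom (fun _ => y) monotone_const
    (fun c => le_antisymm (le_ωSup (c.map ⟨fun _ => y, monotone_const⟩) 0)
      (ωSup_le _ _ fun _ => le_rfl))
    (fun _ _ => const_mem y)

/-- A monotone function preserves the supremum of a chain which attains it. -/
theorem map_ωSup_of_eq {X Y : Type*} [OmegaCompletePartialOrder X] [OmegaCompletePartialOrder Y]
    (f : X →o Y) {c : Chain X} {n : ℕ} (h : ωSup c = c n) : f (ωSup c) = ωSup (c.map f) := by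
  refine le_antisymm ?_ (ωSup_le _ _ fun k => f.monotone (le_ωSup c k))
  rw [h]
  exact le_ωSup (c.map f) n

end Morphisms

/-! ### Subobjects closed under ω-suprema -/

section Induced

variable {X : Type u} (P : ωQbs.{u}) (e : X → P) (he : Function.Injective e)
  (hcl : ∀ c : Chain P, (∀ n, c n ∈ Set.range e) → ωSup c ∈ Set.range e)

/-- The structure induced on `X` by an injection into an ω-quasi-Borel space whose range is
closed under suprema of chains. -/
@[reducible]
noncomputable def inducedStr : OmegaQuasiBorelSpace X :=
  letI : PartialOrder X := PartialOrder.lift e he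
  let eo : X →o P := ⟨e, fun _ _ h => h⟩
  { toOmegaCompletePartialOrder := OmegaCompletePartialOrder.lift eo
      (fun c => (hcl (c.map eo) fun n => ⟨c n, rfl⟩).choose) (fun _ _ h => h)
      (fun c => (hcl (c.map eo) fun n => ⟨c n, rfl⟩).choose_spec)
    randomElements := {α | e ∘ α ∈ randomElements}
    const_mem := fun x => const_mem (e x)
    comp_mem := fun α hα φ hφ => QuasiBorelSpace.comp_mem (e ∘ α) hα φ hφ
    cases_mem := fun U hU hd hc α hα β hβ =>
      cases_mem U hU hd hc (fun n => e ∘ α n) hα (e ∘ β)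
        fun n r hr => congrArg e (hβ n r hr)
    sup_mem := fun α hα => by
      have h := OmegaQuasiBorelSpace.sup_mem
        (⟨⟨fun n r => e (α n r), fun m n hmn r => α.monotone hmn r⟩⟩ : Chain (ℝ → P)) hα
      refine Set.mem_of_eq_of_mem (s := randomElements) (funext fun r => ?_) h
      exact (hcl ((α.map (Pi.evalOrderHom r)).map eo) fun n => ⟨α n r, rfl⟩).choose_spec }

/-- The ω-quasi-Borel space induced by an injection with range closed under suprema of
chains. -/
noncomputable def induced : ωQbs.{u} := @mk X (inducedStr P e he hcl)

/-- The injection defining an induced ω-quasi-Borel space, as a morphism. -/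
noncomputable def inducedι : induced P e he hcl ⟶ P :=
  mkHom (P := induced P e he hcl) e (fun _ _ h => h)
    (fun c => (hcl (c.map ⟨e, fun _ _ h => h⟩) fun n => ⟨c n, rfl⟩).choose_spec)
    (fun _ h => h)

variable {P e he hcl}

/-- Morphisms with values in the range of the injection factor through the induced space. -/
noncomputable def inducedLift {Q : ωQbs.{u}} (f : Q ⟶ P) (g : Q → X) (h : ∀ x, e (g x) = f x) :
    Q ⟶ induced P e he hcl :=
  mkHom (Q := induced P e he hcl) g
    (fun x y hxy => by
      change e (g x) ≤ e (g y)
      rw [h, h]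
      exact hom_monotone f hxy)
    (fun c => he <| by
      have hg : Monotone (β := induced P e he hcl) g := fun x y hxy => by
        change e (g x) ≤ e (g y)
        rw [h, h]
        exact hom_monotone f hxy
      refine ((h _).trans (hom_map_ωSup f c)).trans (Eq.trans ?_
        (hom_map_ωSup (inducedι P e he hcl) (c.map ⟨g, hg⟩)).symm)
      congr 1
      ext n
      exact (h (c n)).symm)
    (fun α hα => by
      change e ∘ (fun r => g (α r)) ∈ randomElements
      have : e ∘ (fun r => g (α r)) = fun r => f (α r) := funext fun r => h _
      rw [this]
      exact hom_comp_mem f hα)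

end Induced

/-! ### Completeness -/

section Limits

/-- The product of a family of ω-quasi-Borel spaces. -/
def pi {ι : Type u} (F : ι → ωQbs.{u}) : ωQbs.{u} :=
  @mk (∀ i, F i)
    { toOmegaCompletePartialOrder := inferInstance
      randomElements := {α | ∀ i, (fun r => α r i) ∈ randomElements (X := F i)}
      const_mem := fun x i => const_mem (x i)
      comp_mem := fun _ hα φ hφ i => QuasiBorelSpace.comp_mem _ (hα i) φ hφ
      cases_mem := fun U hU hd hc α hα _ hβ i =>
        cases_mem U hU hd hc (fun n r => α n r i) (fun n => hα n i) _
          fun n r hr => congrFun (hβ n r hr) i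
      sup_mem := fun α hα i => OmegaQuasiBorelSpace.sup_mem
        (⟨⟨fun n r => α n r i, fun _ _ hmn r => α.monotone hmn r i⟩⟩ : Chain (ℝ → F i))
        fun n => hα n i }

/-- The projections of a product. -/
def piπ {ι : Type u} (F : ι → ωQbs.{u}) (i : ι) : pi F ⟶ F i :=
  mkHom (P := pi F) (fun x => x i) (fun _ _ h => h i) (fun _ => rfl) (fun _ h => h i)

/-- The morphism to a product given by its components. -/
def piLift {ι : Type u} {F : ι → ωQbs.{u}} {Q : ωQbs.{u}} (f : ∀ i, Q ⟶ F i) : Q ⟶ pi F :=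
  mkHom (Q := pi F) (fun x i => f i x) (fun _ _ h i => hom_monotone (f i) h)
    (fun c => funext fun i => hom_map_ωSup (f i) c) (fun _ h i => hom_comp_mem (f i) h)

variable {J : Type u} [SmallCategory J] (F : J ⥤ ωQbs.{u})

/-- Compatible families of points of a diagram. -/
abbrev CompatibleFamily : Type u :=
  {x : ∀ j, F.obj j // ∀ ⦃i j : J⦄ (f : i ⟶ j), F.map f (x i) = x j}

/-- The limit of a diagram: compatible families inside the product. -/
noncomputable def limitObj : ωQbs.{u} :=
  induced (X := CompatibleFamily F) (pi F.obj) Subtype.val Subtype.val_injective fun c hc =>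
    ⟨⟨ωSup c, fun i j f => by
      change F.map f (piπ F.obj i (ωSup c)) = piπ F.obj j (ωSup c)
      simp only [hom_map_ωSup]
      congr 1
      ext n
      obtain ⟨x, hx⟩ := hc n
      change F.map f (c n i) = c n j
      rw [← hx]
      exact x.2 f⟩, rfl⟩

/-- The limit cone of a diagram. -/
noncomputable def limitCone : Cone F where
  pt := limitObj F
  π :=
    { app := fun j => inducedι _ _ _ _ ≫ piπ F.obj j
      naturality := fun _ _ f => hom_ext fun x => (Subtype.property x f).symm }

/-- The limit cone is universal. -/
noncomputable def limitConeIsLimit : IsLimit (limitCone F) where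
  lift s := inducedLift (piLift fun j => s.π.app j)
    (fun x => ⟨fun j => s.π.app j x, fun i j f => by
      exact congrArg (fun g : s.pt ⟶ F.obj j => g x) (s.w f)⟩) fun _ => rfl
  fac s j := rfl
  uniq s m hm := hom_ext fun x => Subtype.ext <| funext fun j =>
    congrArg (fun g : s.pt ⟶ F.obj j => g x) (hm j)

instance : HasLimits ωQbs.{u} :=
  ⟨fun _ _ => ⟨fun F => ⟨⟨⟨limitCone F, limitConeIsLimit F⟩⟩⟩⟩⟩

end Limits

/-! ### Cocompleteness by the adjoint functor theorem -/

section Colimits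

/-- Formal iterated suprema of sequences of generators. -/
inductive SupTree (S : Type u) : Type u
  | leaf : S → SupTree S
  | sup : (ℕ → SupTree S) → SupTree S

/-- `Evaluates s t x` means that the formal supremum `t` has the value `x`. -/
inductive Evaluates {S : Type u} {P : ωQbs.{u}} (s : S → P) : SupTree S → P → Prop
  | leaf (a : S) : Evaluates s (.leaf a) (s a)
  | sup (t : ℕ → SupTree S) (c : Chain P) (h : ∀ n, Evaluates s (t n) (c n)) :
      Evaluates s (.sup t) (ωSup c)

theorem Evaluates.unique {S : Type u} {P : ωQbs.{u}} {s : S → P} {t : SupTree S} {x : P}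
    (hx : Evaluates s t x) : ∀ {y : P}, Evaluates s t y → x = y := by
  induction hx with
  | leaf a => rintro _ ⟨⟩; rfl
  | sup t c h ih =>
    intro y hy
    cases hy with
    | sup _ c' h' =>
      congr 1
      ext n
      exact ih n (h' n)

/-- Every family of points of an ω-quasi-Borel space factors through an ω-quasi-Borel space
carried by a set of formal suprema. -/
theorem exists_induced_supTree {S : Type u} {P : ωQbs.{u}} (s : S → P) :
    ∃ (A : Set (SupTree S)) (e : A → P) (_ : Function.Injective e)
      (_ : ∀ c : Chain P, (∀ n, c n ∈ Set.range e) → ωSup c ∈ Set.range e),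
      ∀ a, s a ∈ Set.range e := by
  let C : Set P := {x | ∃ t, Evaluates s t x}
  choose τ hτ using fun x : C => x.2
  -- A tree has at most one value, so choosing a tree for each point of the closure embeds the
  -- closure into `SupTree S`.
  have hinj : Function.Injective τ := fun x y h => Subtype.ext <| (hτ x).unique (h ▸ hτ y)
  let ε := Equiv.ofInjective τ hinj
  have hrange : ∀ x ∈ C, x ∈ Set.range (fun a => (ε.symm a : P)) :=
    fun x hx => ⟨ε ⟨x, hx⟩, by simp⟩
  refine ⟨Set.range τ, fun a => (ε.symm a : P),
    Subtype.val_injective.comp ε.symm.injective, fun c hc => hrange _ ?_,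
    fun a => hrange _ ⟨_, .leaf a⟩⟩
  choose a ha using hc
  exact ⟨_, .sup (fun n => τ (ε.symm (a n))) c fun n => ha n ▸ hτ _⟩

variable {J : Type u} [SmallCategory J]

theorem solutionSetCondition_const :
    SolutionSetCondition.{u} (Functor.const J : ωQbs.{u} ⥤ J ⥤ ωQbs.{u}) := by
  intro F
  let S : Type u := Σ j, F.obj j
  -- The solution set: all cocones on all structures carried by subsets of `SupTree S`, where `S`
  -- depends on `F` only.
  refine ⟨Σ (A : Set (SupTree S)) (str : OmegaQuasiBorelSpace A),
    F ⟶ (Functor.const J).obj (@mk A str), fun i => @mk i.1 i.2.1, fun i => i.2.2,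
    fun P h => ?_⟩
  obtain ⟨A, e, he, hcl, hs⟩ := exists_induced_supTree fun a : S => h.app a.1 a.2
  choose g hg using hs
  refine ⟨⟨A, inducedStr P e he hcl,
    { app := fun j => inducedLift (he := he) (hcl := hcl) (h.app j) (fun x => g ⟨j, x⟩)
        fun x => hg ⟨j, x⟩
      naturality := fun i j f => hom_ext fun x => he ?_ }⟩, inducedι P e he hcl, ?_⟩
  · exact (hg ⟨j, F.map f x⟩).trans
      ((congrArg (fun k : F.obj i ⟶ P => k x) (h.naturality f)).trans (hg ⟨i, x⟩).symm)
  · ext j : 2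
    exact hom_ext fun x => hg ⟨j, x⟩

instance : HasColimits ωQbs.{u} :=
  ⟨fun _ _ => hasColimitsOfShape_iff_isRightAdjoint_const.2
    (isRightAdjoint_of_preservesLimits_of_solutionSetCondition _ solutionSetCondition_const)⟩

end Colimits

/-! ### Filtered colimits computed on underlying sets -/

section FilteredColimits

variable {J : Type u} [SmallCategory J]

/-- A colimit of the underlying sets of a filtered diagram. -/
structure PointColimit (D : J ⥤ ωQbs.{u}) where
  /-- The colimit set. -/
  pt : Type u
  /-- The inclusions. -/
  incl (j : J) : D.obj j → pt
  incl_map {i j : J} (f : i ⟶ j) (a : D.obj i) : incl j (D.map f a) = incl i a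
  exists_rep (x : pt) : ∃ j a, incl j a = x
  exists_map_eq {i j : J} {a : D.obj i} {b : D.obj j} (h : incl i a = incl j b) :
    ∃ (k : J) (f : i ⟶ k) (g : j ⟶ k), D.map f a = D.map g b

theorem nonempty_pointColimit [IsFiltered J] (D : J ⥤ ωQbs.{u}) :
    Nonempty (PointColimit D) :=
  have ht := colimit.isColimit (D ⋙ forget ωQbs.{u})
  ⟨{ pt := colimit (D ⋙ forget ωQbs.{u})
     incl := fun j a => colimit.ι (D ⋙ forget ωQbs.{u}) j a
     incl_map := fun f a => ConcreteCategory.congr_hom (colimit.w (D ⋙ forget ωQbs.{u}) f) a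
     exists_rep := fun x => Types.jointly_surjective_of_isColimit ht x
     exists_map_eq := fun h => (Types.FilteredColimit.isColimit_eq_iff _ ht).1 h }⟩

theorem map_comp_apply (D : J ⥤ ωQbs.{u}) {i j k : J} (f : i ⟶ j) (g : j ⟶ k) (a : D.obj i) :
    D.map (f ≫ g) a = D.map g (D.map f a) := by
  rw [D.map_comp]; rfl

namespace PointColimit

variable {D : J ⥤ ωQbs.{u}} (t : PointColimit D)

section

variable (κ : Cardinal.{u}) [Fact κ.IsRegular] [IsCardinalFiltered J κ]

include κ

theorem exists_family_rep {K : Type*} (hK : HasCardinalLT K κ) (x : K → t.pt) :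
    ∃ (j : J) (a : K → D.obj j), ∀ k, t.incl j (a k) = x k := by
  choose j a h using fun k => t.exists_rep (x k)
  exact ⟨IsCardinalFiltered.max j hK, fun k => D.map (IsCardinalFiltered.toMax j hK k) (a k),
    fun k => by rw [t.incl_map, h]⟩

/-- Fewer than `κ` arrows out of `i` can be completed to a common target, and stability carries
every property there. This turns pointwise statements into uniform ones. -/
theorem exists_family_of_stable {K : Type*} (hK : HasCardinalLT K κ) {i : J}
    (p : K → ∀ j, (i ⟶ j) → Prop)
    (hp : ∀ k j l (f : i ⟶ j) (g : j ⟶ l), p k j f → p k l (f ≫ g))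
    (h : ∀ k, ∃ j f, p k j f) : ∃ j f, ∀ k, p k j f := by
  choose j f h using h
  obtain ⟨m, a, b, hm⟩ := IsCardinalFiltered.wideSpan f hK
  exact ⟨m, b, fun k => hm k ▸ hp _ _ _ _ _ (h k)⟩

theorem exists_map_eq_self {i : J} {a b : D.obj i} (h : t.incl i a = t.incl i b) :
    ∃ (j : J) (f : i ⟶ j), D.map f a = D.map f b := by
  have := isFiltered_of_isCardinalFiltered J κ
  obtain ⟨k, f, g, h⟩ := t.exists_map_eq h
  -- The two arrows to `k` may differ, so they are coequalized.
  refine ⟨_, f ≫ IsFiltered.coeqHom f g, ?_⟩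
  rw [map_comp_apply, h, ← map_comp_apply, IsFiltered.coeq_condition]

theorem exists_family_map_eq {K : Type*} (hK : HasCardinalLT K κ) {i : J}
    (a b : K → D.obj i) (h : ∀ k, t.incl i (a k) = t.incl i (b k)) :
    ∃ (j : J) (f : i ⟶ j), ∀ k, D.map f (a k) = D.map f (b k) :=
  exists_family_of_stable κ hK (fun k _ f => D.map f (a k) = D.map f (b k))
    (fun k j l f g hf => by simp only [map_comp_apply, hf])
    fun k => t.exists_map_eq_self κ (h k)

/-- The order on a colimit of points: inequalities hold at some stage. -/
def Le (x y : t.pt) : Prop := ∃ (j : J) (a b : D.obj j), t.incl j a = x ∧ t.incl j b = y ∧ a ≤ b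

omit κ [Fact κ.IsRegular] [IsCardinalFiltered J κ] in
theorem Le.of_le {j : J} {a b : D.obj j} (h : a ≤ b) : t.Le (t.incl j a) (t.incl j b) :=
  ⟨j, a, b, rfl, rfl, h⟩

theorem exists_map_le {i : J} {a b : D.obj i} (h : t.Le (t.incl i a) (t.incl i b)) :
    ∃ (j : J) (f : i ⟶ j), D.map f a ≤ D.map f b := by
  have := isFiltered_of_isCardinalFiltered J κ
  obtain ⟨j, a', b', ha, hb, hab⟩ := h
  obtain ⟨k₁, f₁, g₁, h₁⟩ := t.exists_map_eq ha
  obtain ⟨k₂, f₂, g₂, h₂⟩ := t.exists_map_eq hb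
  obtain ⟨m, u, v, hf, hg⟩ := IsFiltered.bowtie f₁ f₂ g₁ g₂
  refine ⟨m, g₁ ≫ u, ?_⟩
  rw [map_comp_apply, ← h₁, hg, map_comp_apply, ← h₂, ← map_comp_apply, ← map_comp_apply, hf]
  exact hom_monotone _ hab

theorem exists_family_map_le {K : Type*} (hK : HasCardinalLT K κ) {i : J}
    (a b : K → D.obj i) (h : ∀ k, t.Le (t.incl i (a k)) (t.incl i (b k))) :
    ∃ (j : J) (f : i ⟶ j), ∀ k, D.map f (a k) ≤ D.map f (b k) :=
  exists_family_of_stable κ hK (fun k _ f => D.map f (a k) ≤ D.map f (b k))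
    (fun k j l f g hf => by simpa only [map_comp_apply] using hom_monotone (D.map g) hf)
    fun k => t.exists_map_le κ (h k)

/-- The partial order on a colimit of points. -/
@[reducible]
def partialOrder : PartialOrder t.pt where
  le := t.Le
  le_refl x := by
    obtain ⟨j, a, rfl⟩ := t.exists_rep x
    exact Le.of_le t le_rfl
  le_trans x y z hxy hyz := by
    obtain ⟨j, a, h⟩ := t.exists_family_rep κ
      (hasCardinalLT_of_finite _ _ (Fact.out : κ.IsRegular).aleph0_le) ![x, y, z]
    obtain rfl : t.incl j (a 0) = x := h 0
    obtain rfl : t.incl j (a 1) = y := h 1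
    obtain rfl : t.incl j (a 2) = z := h 2
    obtain ⟨k, f, hf⟩ := t.exists_family_map_le κ
      (hasCardinalLT_of_finite Bool _ (Fact.out : κ.IsRegular).aleph0_le)
      (fun b => if b then a 0 else a 1) (fun b => if b then a 1 else a 2)
      (by rintro (_ | _) <;> assumption)
    rw [← t.incl_map f, ← t.incl_map f (a 2)]
    exact Le.of_le t ((hf true).trans (hf false))
  le_antisymm x y hxy hyx := by
    obtain ⟨j, a, h⟩ := t.exists_family_rep κ
      (hasCardinalLT_of_finite _ _ (Fact.out : κ.IsRegular).aleph0_le) ![x, y]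
    obtain rfl : t.incl j (a 0) = x := h 0
    obtain rfl : t.incl j (a 1) = y := h 1
    obtain ⟨k, f, hf⟩ := t.exists_family_map_le κ
      (hasCardinalLT_of_finite Bool _ (Fact.out : κ.IsRegular).aleph0_le)
      (fun b => if b then a 0 else a 1) (fun b => if b then a 1 else a 0)
      (by rintro (_ | _) <;> assumption)
    rw [← t.incl_map f, ← t.incl_map f (a 1)]
    exact congrArg _ (le_antisymm (hf true) (hf false))

variable (hκ : HasCardinalLT ℝ κ)

include hκ

omit [Fact κ.IsRegular] [IsCardinalFiltered J κ] in
theorem hasCardinalLT_nat : HasCardinalLT ℕ κ :=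
  hκ.of_injective _ Nat.cast_injective

theorem exists_chain_rep (c : ℕ → t.pt) (hc : ∀ n, t.Le (c n) (c (n + 1))) :
    ∃ (j : J) (c' : Chain (D.obj j)), ∀ n, t.incl j (c' n) = c n := by
  obtain ⟨i, a, ha⟩ := t.exists_family_rep κ (hasCardinalLT_nat κ hκ) c
  obtain ⟨j, f, hf⟩ := t.exists_family_map_le κ (hasCardinalLT_nat κ hκ) a (fun n => a (n + 1))
    (fun n => by rw [ha, ha]; exact hc n)
  exact ⟨j, ⟨⟨fun n => D.map f (a n), monotone_nat_of_le_succ hf⟩⟩,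
    fun n => (t.incl_map f _).trans (ha n)⟩

theorem isLUB_incl_ωSup {j : J} (c : Chain (D.obj j)) :
    letI := t.partialOrder κ
    IsLUB (Set.range fun n => t.incl j (c n)) (t.incl j (ωSup c)) := by
  have := isFiltered_of_isCardinalFiltered J κ
  refine ⟨?_, fun y hy => ?_⟩
  · rintro _ ⟨n, rfl⟩
    exact Le.of_le t (le_ωSup c n)
  · obtain ⟨i, b, rfl⟩ := t.exists_rep y
    rw [← t.incl_map (IsFiltered.leftToMax j i), ← t.incl_map (IsFiltered.rightToMax j i)]
    obtain ⟨k, f, hf⟩ := t.exists_family_map_le κ (hasCardinalLT_nat κ hκ)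
      (fun n => D.map (IsFiltered.leftToMax j i) (c n))
      (fun _ => D.map (IsFiltered.rightToMax j i) b)
      (fun n => by
        rw [t.incl_map, t.incl_map]
        exact hy ⟨n, rfl⟩)
    rw [← t.incl_map f, ← t.incl_map f]
    refine Le.of_le t ?_
    rw [hom_map_ωSup, hom_map_ωSup]
    exact ωSup_le _ _ hf

/-- The ω-cpo structure on a colimit of points. -/
@[reducible]
noncomputable def omegaCompletePartialOrder : OmegaCompletePartialOrder t.pt :=
  letI := t.partialOrder κ
  have h (c : Chain t.pt) : ∃ x, IsLUB (Set.range c) x := by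
    obtain ⟨j, c', hc⟩ := t.exists_chain_rep κ hκ c fun n => c.monotone n.le_succ
    have hlub := t.isLUB_incl_ωSup κ hκ c'
    rw [funext hc] at hlub
    exact ⟨_, hlub⟩
  { ωSup := fun c => (h c).choose
    le_ωSup := fun c n => (h c).choose_spec.1 ⟨n, rfl⟩
    ωSup_le := fun c x hx => (h c).choose_spec.2 (by rintro _ ⟨n, rfl⟩; exact hx n) }

theorem ωSup_eq {j : J} (c : letI := t.partialOrder κ; Chain t.pt) (c' : Chain (D.obj j))
    (h : ∀ n, t.incl j (c' n) = c n) :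
    letI := t.omegaCompletePartialOrder κ hκ
    ωSup c = t.incl j (ωSup c') := by
  let := t.omegaCompletePartialOrder κ hκ
  refine (ωSup_eq_of_isLUB ?_).symm
  have := t.isLUB_incl_ωSup κ hκ c'
  rwa [funext h] at this

/-- The ω-quasi-Borel structure on a colimit of points. -/
@[reducible]
noncomputable def omegaQuasiBorelSpace : OmegaQuasiBorelSpace t.pt where
  toOmegaCompletePartialOrder := t.omegaCompletePartialOrder κ hκ
  randomElements := {α | ∃ (j : J) (α' : ℝ → D.obj j), α' ∈ randomElements ∧
    ∀ r, t.incl j (α' r) = α r}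
  const_mem x := by
    obtain ⟨j, a, rfl⟩ := t.exists_rep x
    exact ⟨j, fun _ => a, const_mem a, fun _ => rfl⟩
  comp_mem := by
    rintro α ⟨j, α', hα', h⟩ φ hφ
    exact ⟨j, α' ∘ φ, QuasiBorelSpace.comp_mem _ hα' φ hφ, fun r => h (φ r)⟩
  cases_mem U hU hd hc α hα β hβ := by
    choose j α' hα' h using hα
    have hr (r : ℝ) : ∃ n, r ∈ U n := Set.mem_iUnion.1 (hc ▸ Set.mem_univ r)
    choose n hn using hr
    let f := IsCardinalFiltered.toMax j (hasCardinalLT_nat κ hκ)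
    refine ⟨_, fun r => D.map (f (n r)) (α' (n r) r),
      cases_mem U hU hd hc (fun n r => D.map (f n) (α' n r))
        (fun n => hom_comp_mem (D.map (f n)) (hα' n)) _ fun m r hr => ?_,
      fun r => ?_⟩
    · obtain rfl : n r = m := by
        by_contra hne
        exact Set.disjoint_left.1 (hd hne) (hn r) hr
      rfl
    · rw [t.incl_map, h, hβ (n r) r (hn r)]
  sup_mem α hα := by
    let := t.partialOrder κ
    choose j α' hα' h using hα
    let f := IsCardinalFiltered.toMax j (hasCardinalLT_nat κ hκ)
    let β (p : ℕ × ℝ) := D.map (f p.1) (α' p.1 p.2)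
    have hβ (n r) : t.incl _ (β (n, r)) = α n r := (t.incl_map _ _).trans (h n r)
    -- The representatives need not increase with `n` at the current stage. Correcting this takes `ℕ
    -- × ℝ` many inequalities at once, hence a `κ` above the continuum.
    obtain ⟨k, g, hg⟩ := t.exists_family_map_le κ
      (hasCardinalLT_prod (Fact.out : κ.IsRegular).aleph0_le (hasCardinalLT_nat κ hκ) hκ)
      β (fun p => β (p.1 + 1, p.2)) (fun p => by
        rw [hβ, hβ]
        exact α.monotone p.1.le_succ p.2)
    let γ : Chain (ℝ → D.obj k) :=
      ⟨⟨fun n r => D.map g (β (n, r)), monotone_nat_of_le_succ fun n r => hg (n, r)⟩⟩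
    refine ⟨k, _, OmegaQuasiBorelSpace.sup_mem γ fun n =>
      hom_comp_mem (D.map (f n) ≫ D.map g) (hα' n), fun r => ?_⟩
    exact (t.ωSup_eq κ hκ _ _ fun n => (t.incl_map g _).trans (hβ n r)).symm

/-- The colimit of a `κ`-filtered diagram, carried by the colimit of points. -/
noncomputable def obj : ωQbs.{u} := @ωQbs.mk t.pt (t.omegaQuasiBorelSpace κ hκ)

/-- The colimit cocone of a `κ`-filtered diagram. -/
noncomputable def cocone : Cocone D where
  pt := t.obj κ hκ
  ι :=
    { app := fun j => mkHom (Q := t.obj κ hκ) (t.incl j) (fun _ _ h => Le.of_le t h)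
        (fun c => (t.ωSup_eq κ hκ _ c fun _ => rfl).symm)
        (fun α hα => ⟨j, α, hα, fun _ => rfl⟩)
      naturality := fun _ _ f => hom_ext fun a => t.incl_map f a }

/-- The colimit cocone is universal. -/
noncomputable def coconeIsColimit : IsColimit (t.cocone κ hκ) := by
  choose j a ha using t.exists_rep
  -- The value of a cocone does not depend on the chosen representative.
  have key (s : Cocone D) (i : J) (b : D.obj i) :
      s.ι.app (j (t.incl i b)) (a (t.incl i b)) = s.ι.app i b := by
    obtain ⟨k, f, g, h⟩ := t.exists_map_eq (ha (t.incl i b))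
    rw [← s.w f, ← s.w g, ConcreteCategory.comp_apply, h]
    rfl
  have hmono (s : Cocone D) (x y : t.pt) (h : t.Le x y) :
      s.ι.app (j x) (a x) ≤ s.ι.app (j y) (a y) := by
    obtain ⟨i, b, c, rfl, rfl, hbc⟩ := h
    rw [key, key]
    exact hom_monotone _ hbc
  refine
    { desc := fun s => mkHom (P := t.obj κ hκ) (fun x => s.ι.app (j x) (a x)) (hmono s) ?_ ?_
      fac := fun s i => hom_ext (key s i)
      uniq := fun s m hm => hom_ext fun x => ?_ }
  · intro c
    obtain ⟨i, c', hc⟩ := t.exists_chain_rep κ hκ c fun n => c.monotone n.le_succ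
    have hsup : (ωSup c : t.obj κ hκ) = t.incl i (ωSup c') := t.ωSup_eq κ hκ c c' hc
    let F : t.pt → s.pt := fun x => s.ι.app (j x) (a x)
    have hF : F (ωSup c : t.obj κ hκ) = F (t.incl i (ωSup c')) := congrArg F hsup
    refine (hF.trans ((key s i (ωSup c')).trans (hom_map_ωSup (s.ι.app i) c'))).trans ?_
    congr 1
    ext n
    exact (key s i (c' n)).symm.trans (by rw [hc]; rfl)
  · rintro α ⟨i, α', hα', h⟩
    obtain rfl : (fun r => t.incl i (α' r)) = α := funext h
    simp only [key]
    exact hom_comp_mem _ hα'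
  · change _ = s.ι.app (j x) (a x)
    rw [← hm (j x)]
    exact congrArg m (ha x).symm

end

end PointColimit

end FilteredColimits

/-! ### The strong generator -/

section Generators

theorem measurable_of_cases {Y : Type*} [MeasurableSpace Y] {U : ℕ → Set ℝ}
    (hU : ∀ n, MeasurableSet (U n)) (hc : ⋃ n, U n = Set.univ) {α : ℕ → ℝ → Y}
    (hα : ∀ n, Measurable (α n)) {β : ℝ → Y} (hβ : ∀ n, ∀ r ∈ U n, β r = α n r) :
    Measurable β := by
  intro s hs
  have : β ⁻¹' s = ⋃ n, U n ∩ α n ⁻¹' s := by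
    ext r
    obtain ⟨n, hn⟩ := Set.mem_iUnion.1 (hc ▸ Set.mem_univ r)
    simp only [Set.mem_preimage, Set.mem_iUnion, Set.mem_inter_iff]
    exact ⟨fun h => ⟨n, hn, hβ n r hn ▸ h⟩, fun ⟨m, hm, h⟩ => hβ m r hm ▸ h⟩
  rw [this]
  exact .iUnion fun n => (hU n).inter (hα n hs)

/-- The carrier of the real line with the discrete order. -/
structure DiscreteReal : Type u where
  /-- The underlying real number. -/
  val : ℝ

instance : PartialOrder DiscreteReal.{u} where
  le := Eq
  le_refl _ := rfl
  le_trans _ _ _ := Eq.trans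
  le_antisymm _ _ h _ := h

instance : OmegaQuasiBorelSpace DiscreteReal.{u} where
  ωSup c := c 0
  le_ωSup c n := (c.monotone n.zero_le).symm
  ωSup_le _ _ h := h 0
  randomElements := {α | Measurable fun r => (α r).val}
  const_mem _ := measurable_const
  comp_mem α (hα : Measurable fun r => (α r).val) _ hφ := hα.comp hφ
  cases_mem _ hU _ hc _ hα _ hβ :=
    measurable_of_cases hU hc hα fun n r hr => congrArg DiscreteReal.val (hβ n r hr)
  sup_mem _ h := h 0

/-- The real line with the discrete order and the measurable functions. -/
def real : ωQbs.{u} := ⟨DiscreteReal⟩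

/-- Since suprema are attained, monotone maps out of the two-element chain are automatically
Scott-continuous. -/
theorem exists_ωSup_eq_bool (c : Chain (ULift.{u} Bool)) : ∃ n, ωSup c = c n := by
  by_cases h : ∃ n, c n = ⟨true⟩
  · obtain ⟨n, hn⟩ := h
    exact ⟨n, le_antisymm (hn ▸ Bool.le_true _) (le_ωSup c n)⟩
  · refine ⟨0, le_antisymm (ωSup_le _ _ fun n => ?_) (le_ωSup c 0)⟩
    have hn : c n = ⟨false⟩ := ULift.ext _ _ <| Bool.eq_false_iff.2 fun hn => h ⟨n, ULift.ext _ _ hn⟩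
    exact hn ▸ Bool.false_le _

/-- The measurable functions to the two-element chain. -/
@[reducible]
noncomputable def twoChainStr : OmegaQuasiBorelSpace (ULift.{u} Bool) where
  toOmegaCompletePartialOrder := inferInstance
  randomElements := {α | Measurable fun r => (α r).down}
  const_mem _ := measurable_const
  comp_mem α (hα : Measurable fun r => (α r).down) _ hφ := hα.comp hφ
  cases_mem U hU _ hc α hα _ hβ :=
    measurable_of_cases hU hc hα fun n r hr => congrArg ULift.down (hβ n r hr)
  sup_mem α hα := by
    refine measurable_to_bool ?_
    have : (fun r => (ωSup (α.map (Pi.evalOrderHom r))).down) ⁻¹' {true} =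
        ⋃ n, (fun r => (α n r).down) ⁻¹' {true} := by
      ext r
      simp only [Set.mem_preimage, Set.mem_singleton_iff, Set.mem_iUnion]
      refine ⟨fun h => ?_, fun ⟨n, hn⟩ => ?_⟩
      · obtain ⟨n, hn⟩ := exists_ωSup_eq_bool (α.map (Pi.evalOrderHom r))
        exact ⟨n, (congrArg ULift.down hn).symm.trans h⟩
      · exact Bool.eq_true_of_true_le (hn ▸ le_ωSup (α.map (Pi.evalOrderHom r)) n)
    rw [this]
    exact .iUnion fun n => hα n (measurableSet_singleton _)

/-- The two-element chain with the measurable functions. -/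
noncomputable def twoChain : ωQbs.{u} := @mk (ULift.{u} Bool) twoChainStr

variable {P Q : ωQbs.{u}}

/-- Random elements as morphisms from the real line. -/
def ofRandomElement (α : ℝ → P) (hα : α ∈ randomElements) : real.{u} ⟶ P :=
  have hmono : Monotone fun r : real.{u} => α (DiscreteReal.val r) :=
    fun _ _ h => le_of_eq (congrArg (fun r : DiscreteReal => α r.val) h)
  mkHom (P := real) _ hmono
    (fun c => map_ωSup_of_eq ⟨_, hmono⟩ (c := c) (n := 0) rfl)
    (fun _ hφ => QuasiBorelSpace.comp_mem α hα _ hφ)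

theorem randomElement_mem (f : real.{u} ⟶ P) :
    (fun r => f (DiscreteReal.mk r)) ∈ randomElements (X := P) :=
  hom_comp_mem f (α := DiscreteReal.mk) measurable_id

/-- Inequalities as morphisms from the two-element chain. -/
noncomputable def ofLe {x y : P} (h : x ≤ y) : twoChain.{u} ⟶ P :=
  have hmono : Monotone fun b : twoChain.{u} => cond (ULift.down b) y x := by
    rintro ⟨_ | _⟩ ⟨_ | _⟩ hb
    · exact le_rfl
    · exact h
    · exact absurd (show true ≤ false from hb) (by decide)
    · exact le_rfl
  mkHom (P := twoChain) _ hmono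
    (fun c => map_ωSup_of_eq ⟨_, hmono⟩ (exists_ωSup_eq_bool c).choose_spec)
    (fun α hα => by
      have hα' : Measurable fun r => (α r).down := hα
      -- Only the pieces `n = 0` and `n = 1` can be nonempty; they are the preimages of `false` and
      -- `true`.
      refine cases_mem (fun n => {r | (α r).down.toNat = n})
        (fun n => ((measurable_of_countable Bool.toNat).comp hα') (measurableSet_singleton n))
        (fun m n hmn => Set.disjoint_left.2 fun r hm hn => hmn (hm.symm.trans hn))
        (Set.eq_univ_of_forall fun r => Set.mem_iUnion.2 ⟨_, rfl⟩)
        (fun n _ => if n = 0 then x else y) (fun n => const_mem _) _ ?_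
      rintro _ r rfl
      cases (α r).down <;> rfl)

/-- Lifting constants gives surjectivity, lifting inequalities makes the inverse monotone, and
lifting random elements makes it a morphism; continuity of the inverse follows from injectivity of
`i`. -/
theorem isIso_of_lifts (i : P ⟶ Q) (hi : Function.Injective i)
    (hreal : Surjective fun f : real ⟶ P => f ≫ i)
    (htwo : Surjective fun f : twoChain ⟶ P => f ≫ i) : IsIso i := by
  have hle {x y : P} (h : i x ≤ i y) : x ≤ y := by
    obtain ⟨f, hf⟩ := htwo (ofLe h)
    have hf' (b : ULift Bool) : i (f b) = ofLe h b := congrArg (fun g : twoChain ⟶ Q => g b) hf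
    rw [← hi (hf' ⟨false⟩), ← hi (hf' ⟨true⟩)]
    exact hom_monotone f (show (⟨false⟩ : ULift.{u} Bool) ≤ ⟨true⟩ from Bool.false_le _)
  have hsurj (y : Q) : ∃ x, i x = y := by
    obtain ⟨f, hf⟩ := hreal (constHom _ y)
    exact ⟨f (DiscreteReal.mk 0), congrArg (fun g : real ⟶ Q => g (DiscreteReal.mk 0)) hf⟩
  choose g hg using hsurj
  have hmono : Monotone g := fun x y h => hle (by rwa [hg, hg])
  refine ⟨mkHom g hmono (fun c => hi ?_) (fun α hα => ?_),
    hom_ext fun x => hi (hg _), hom_ext hg⟩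
  · rw [hg, hom_map_ωSup]
    congr 1
    ext n
    exact (hg (c n)).symm
  · obtain ⟨f, hf⟩ := hreal (ofRandomElement α hα)
    convert randomElement_mem f using 1
    funext r
    exact hi ((hg _).trans
      (congrArg (fun g : real ⟶ Q => g (DiscreteReal.mk r)) hf).symm)

/-- The real line and the two-element chain. -/
noncomputable def generator (b : Bool) : ωQbs.{u} := cond b real twoChain

theorem isStrongGenerator_generator :
    (ObjectProperty.ofObj generator.{u}).IsStrongGenerator := by
  rw [ObjectProperty.isStrongGenerator_iff]
  refine ⟨fun P Q f g h => hom_ext fun x => ?_, fun P Q i _ hi => isIso_of_lifts i ?_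
    (hi _ (ObjectProperty.ofObj_apply generator true))
    (hi _ (ObjectProperty.ofObj_apply generator false))⟩
  · exact congrArg (fun k : real ⟶ Q => k (DiscreteReal.mk 0))
      (h _ (ObjectProperty.ofObj_apply generator true) (constHom _ x))
  · intro x y hxy
    have : constHom real x = constHom real y :=
      (cancel_mono i).1 (hom_ext fun _ => hxy)
    exact congrArg (fun k : real ⟶ P => k (DiscreteReal.mk 0)) this

end Generators

/-! ### Presentability of the generators -/

section Presentable

variable (κ : Cardinal.{u}) [Fact κ.IsRegular] (hκ : HasCardinalLT ℝ κ)

/-- Essential uniqueness of a factorization is automatic: `G` has fewer than `κ` points, so two maps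
identified in the colimit agree at one later stage. Only existence depends on `G`. -/
theorem isCardinalPresentable_of_exists_lift {G : ωQbs.{u}} (hG : HasCardinalLT G κ)
    (h : ∀ (J : Type u) [SmallCategory J] [IsCardinalFiltered J κ] (D : J ⥤ ωQbs.{u})
      (t : PointColimit D) (f : G ⟶ t.obj κ hκ),
      ∃ (j : J) (g : G ⟶ D.obj j), ∀ x, t.incl j (g x) = f x) :
    IsCardinalPresentable G κ where
  preservesColimitOfShape J _ _ := ⟨fun {D} => by
    have := isFiltered_of_isCardinalFiltered J κ
    obtain ⟨t⟩ := nonempty_pointColimit D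
    refine preservesColimit_of_preserves_colimit_cocone (t.coconeIsColimit κ hκ)
      (Types.FilteredColimit.isColimitOf' _ _ (fun f => ?_) fun j (f g : G ⟶ D.obj j) hfg => ?_)
    · obtain ⟨j, g, hg⟩ := h J D t f
      exact ⟨j, g, hom_ext fun x => (hg x).symm⟩
    · obtain ⟨k, u, hu⟩ := t.exists_family_map_eq κ hG (fun x => f x)
        (fun x => g x)
        fun x => congrArg (fun k : G ⟶ t.obj κ hκ => k x) hfg
      exact ⟨k, u, hom_ext hu⟩⟩

include hκ

theorem isCardinalPresentable_real : IsCardinalPresentable real.{u} κ := by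
  refine isCardinalPresentable_of_exists_lift κ hκ
    (hκ.of_injective (DiscreteReal.val : real.{u} → ℝ) fun ⟨_⟩ ⟨_⟩ h => by congr) ?_
  intro J _ _ D t f
  -- By construction, a random element of the colimit comes from one stage.
  obtain ⟨j, α, hα, h⟩ := randomElement_mem f
  exact ⟨j, ofRandomElement α hα, fun x => h x.val⟩

theorem isCardinalPresentable_twoChain : IsCardinalPresentable twoChain.{u} κ := by
  refine isCardinalPresentable_of_exists_lift κ hκ
    (hasCardinalLT_of_finite (ULift.{u} Bool) _ (Fact.out : κ.IsRegular).aleph0_le) ?_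
  intro J _ _ D t f
  obtain ⟨j, a, b, ha, hb, hab⟩ : t.Le (f (ULift.up false : ULift Bool))
      (f (ULift.up true : ULift Bool)) :=
    hom_monotone f (show (⟨false⟩ : ULift.{u} Bool) ≤ ⟨true⟩ from Bool.false_le _)
  refine ⟨j, ofLe hab, ?_⟩
  rintro ⟨_ | _⟩
  · exact ha
  · exact hb

theorem isCardinalLocallyPresentable : IsCardinalLocallyPresentable ωQbs.{u} κ := by
  rw [IsCardinalLocallyPresentable.iff_exists_isStrongGenerator]
  refine ⟨_, inferInstance, isStrongGenerator_generator, ?_⟩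
  rintro _ ⟨_ | _⟩
  · exact isCardinalPresentable_twoChain κ hκ
  · exact isCardinalPresentable_real κ hκ

end Presentable

end ωQbs

theorem mainTheorem7 :
    IsCardinalLocallyPresentable ωQbs.{u} (Order.succ Cardinal.continuum.{u}) ∧
      HasLimitsOfSize.{u, u} ωQbs.{u} ∧ HasColimitsOfSize.{u, u} ωQbs.{u} := by
  refine ⟨ωQbs.isCardinalLocallyPresentable _ ?_, inferInstance, inferInstance⟩
  rw [HasCardinalLT, Cardinal.mk_real, Cardinal.lift_continuum, Cardinal.lift_uzero]
  exact Order.lt_succ _
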